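/- Metrics are allowed to take the value $\infty$, distinct points are at positive distance, and the empty space is allowed. Let $\mathrm{CMet}$ be the category of complete metric spaces and non-expansive maps ($d_Y(fx,fx')\le d_X(x,x')$ for all $x,x'$). A metric space $(X,d)$ is a \emph{path} (or \emph{intrinsic}) metric space if for all $x,y\in X$ the distance $d(x,y)$ is the infimum in $[0,\infty]$ of the lengths of the continuous curves $\gamma:[a,b]\to X$ with $\gamma(a)=x$ and $\gamma(b)=y$ (the infimum of the empty set being $\infty$), where the length of $\gamma$ is the supremum of $\sum_i d(\gamma(t_i),\gamma(t_{i+1}))$ over all partitions $a=t_0\le t_1\le\dots\le t_n=b$. Let $\mathrm{CPMet}$ be the full subcategory of $\mathrm{CMet}$ on the complete path metric spaces. Then: 1. $\mathrm{CPMet}$ is locally $\aleph_1$-presentable: it is cocomplete and has a set of $\aleph_1$-presentable objects such that every object is an $\aleph_1$-filtered colimit of objects from this set. 2. The segments $[0,\ell]\subset\mathbb{R}$ with $\ell\in\mathbb{R}_{\ge 0}$ are $\aleph_1$-presentable objects of $\mathrm{CPMet}$ and form a strong generator: they are a separating family, and a monomorphism $A\to X$ through which every morphism $[0,\ell]\to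 X$, $\ell\in\mathbb{R}_{\ge0}$, factors is an isomorphism. Moreover, every object $X$ admits an extremal epimorphism $\coprod_{i\in I}[0,\ell_i]\to X$ in $\mathrm{CPMet}$ from a coproduct of a (small) family of segments, i.e. an epimorphism $e$ such that in every factorization $e=m\circ p$ with $m$ a monomorphism, $m$ is an isomorphism. 3. Both in $\mathrm{CPMet}$ and in $\mathrm{CMet}$, a morphism is a monomorphism if and only if it is an injective map. -/

import Mathlib

open CategoryTheory CategoryTheory.Limits
open scoped NNReal ENNReal Cardinal

universe u

/-- The intrinsic distance: the infimum of the lengths of all continuous curves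
`γ : [a, b] → X` from `x` to `y` (it is `∞` if there is no such curve). A curve is given by a
function on `ℝ`, of which only the restriction to `[a, b]` matters. -/
noncomputable def pathEDist {X : Type*} [EMetricSpace X] (x y : X) : ℝ≥0∞ :=
  sInf {L : ℝ≥0∞ | ∃ (a b : ℝ) (γ : ℝ → X), a ≤ b ∧ ContinuousOn γ (Set.Icc a b) ∧
    γ a = x ∧ γ b = y ∧ L = eVariationOn γ (Set.Icc a b)}

/-- Path (length, intrinsic) metric spaces: the distance is the intrinsic distance. -/
def IsPathMetric (X : Type*) [EMetricSpace X] : Prop :=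
  ∀ x y : X, edist x y = pathEDist x y

/-- Complete metric spaces, with possibly infinite distances. -/
structure CMet : Type (u + 1) where
  carrier : Type u
  [eMetricSpace : EMetricSpace carrier]
  [completeSpace : CompleteSpace carrier]

namespace CMet

instance : CoeSort CMet.{u} (Type u) := ⟨CMet.carrier⟩

attribute [instance] CMet.eMetricSpace CMet.completeSpace

/-- Morphisms of metric spaces: the non-expansive maps. -/
@[ext]
structure Hom (X Y : CMet.{u}) : Type u where
  toFun : X → Y
  lipschitz : LipschitzWith 1 toFun

instance (X Y : CMet.{u}) : FunLike (Hom X Y) X Y where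
  coe := Hom.toFun
  coe_injective _ _ h := Hom.ext h

instance : Category.{u} CMet.{u} where
  Hom X Y := Hom X Y
  id X := ⟨id, LipschitzWith.id⟩
  comp f g := ⟨g.toFun ∘ f.toFun, by simpa using g.lipschitz.comp f.lipschitz⟩

instance : ConcreteCategory CMet.{u} (fun X Y => Hom X Y) where
  hom f := f
  ofHom f := f

end CMet

/-- The full subcategory of `CMet` on the complete path metric spaces. -/
abbrev CPMet : Type (u + 1) :=
  ObjectProperty.FullSubcategory (fun X : CMet.{u} => IsPathMetric X)

theorem le_pathEDist {X : Type*} [EMetricSpace X] (x y : X) : edist x y ≤ pathEDist x y := by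
  refine le_sInf ?_
  rintro L ⟨a, b, γ, hab, -, rfl, rfl, rfl⟩
  exact eVariationOn.edist_le γ (Set.left_mem_Icc.2 hab) (Set.right_mem_Icc.2 hab)

theorem pathEDist_le_of_lipschitz {X : Type*} [EMetricSpace X] {a b : ℝ} (hab : a ≤ b)
    {γ : ℝ → X} (hγ : LipschitzWith 1 γ) :
    pathEDist (γ a) (γ b) ≤ ENNReal.ofReal (b - a) := by
  have h0 : pathEDist (γ a) (γ b) ≤ eVariationOn γ (Set.Icc a b) :=
    sInf_le ⟨a, b, γ, hab, hγ.continuous.continuousOn, rfl, rfl, rfl⟩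
  have h1 := (hγ.lipschitzOnWith (s := Set.univ)).comp_eVariationOn_le
    (g := (id : ℝ → ℝ)) (s := Set.Icc a b) (Set.mapsTo_univ _ _)
  have h2 := (monotone_id.monotoneOn (Set.Icc a b)).eVariationOn_eq
    (Set.left_mem_Icc.2 hab) (Set.right_mem_Icc.2 hab)
  simp only [ENNReal.coe_one, one_mul, Function.comp_id, Set.inter_self, id] at h1 h2
  exact h0.trans (h1.trans h2.le)

/-- The segment `[0, ℓ]`, in any universe. -/
abbrev Segment (ℓ : ℝ≥0) : Type u := ULift.{u} (Set.Icc (0 : ℝ) ℓ)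

theorem isPathMetric_segment (ℓ : ℝ≥0) : IsPathMetric (Segment.{u} ℓ) := by
  let p : ℝ → Segment.{u} ℓ := fun t => ULift.up (Set.projIcc 0 (ℓ : ℝ) ℓ.2 t)
  have hp : LipschitzWith 1 p := fun s t => LipschitzWith.projIcc ℓ.2 s t
  have hn : LipschitzWith 1 (fun t => p (-t)) := by
    have h := hp.comp (LipschitzWith.id (α := ℝ)).neg
    rw [mul_one] at h
    exact h
  have hpx : ∀ x : Set.Icc (0 : ℝ) ℓ, p x = ULift.up x := fun x =>
    congrArg ULift.up (Set.projIcc_val ℓ.2 x)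
  rintro ⟨x⟩ ⟨y⟩
  refine le_antisymm (le_pathEDist _ _) ?_
  have hd : edist (ULift.up x : Segment.{u} ℓ) (ULift.up y)
      = ENNReal.ofReal |(x : ℝ) - y| := by
    rw [ULift.edist_up_up, Subtype.edist_eq, edist_dist, Real.dist_eq]
  rw [hd]
  rcases le_total (x : ℝ) y with h | h
  · have := pathEDist_le_of_lipschitz h hp
    rw [hpx, hpx] at this
    rwa [abs_sub_comm, abs_of_nonneg (sub_nonneg.2 h)]
  · have := pathEDist_le_of_lipschitz (neg_le_neg h) hn
    rw [neg_neg, neg_neg, hpx, hpx] at this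
    rwa [abs_of_nonneg (sub_nonneg.2 h), sub_eq_neg_add, add_comm, ← sub_eq_add_neg,
      ← neg_sub_neg]

/-- The segment `[0, ℓ]` as a complete path metric space. -/
def CPMet.segment (ℓ : ℝ≥0) : CPMet.{u} where
  obj := { carrier := Segment.{u} ℓ }
  property := isPathMetric_segment ℓ

instance fact_isRegular_alephOne : Fact (ℵ₁ : Cardinal.{u}).IsRegular :=
  ⟨Cardinal.isRegular_aleph_one⟩

/-! A cocomplete category with a strong generator of `ℵ₁`-presentable objects is locally
`ℵ₁`-presentable, so the work lies in three facts about path metric spaces. Arc-length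
parametrization makes them accessible: `X` is a path metric space iff points at distance less than
`r` are joined by a non-expansive curve on a segment of length `r` (`isPathMetric_iff_lipJoined`).

Cocompleteness: in `CMet` a colimit is the completion of the largest compatible pseudometric on the
points of the diagram. Replacing a metric by the intrinsic one keeps completeness, because
infinitely many curves of summable length can be concatenated; this is right adjoint to the
inclusion, so `CPMet` is coreflective in `CMet` and inherits its colimits.

Presentability: in an `ℵ₁`-filtered colimit, distances are infima attained at some stage, countably
many points lift together to one stage without increasing distances, and the legs are jointly
surjective. Hence a map from a nonempty separable space factors through a stage, essentially
uniquely.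

Strong generation: the segment of length `0` detects points, and the longer ones detect distances.
-/

/-! ### Non-expansive curves and their concatenation -/

/-- The points `x` and `y` are the values at `0` and `r` of a non-expansive map `ℝ → X`. -/
def LipJoined {X : Type*} [EMetricSpace X] (r : ℝ≥0) (x y : X) : Prop :=
  ∃ γ : ℝ → X, LipschitzWith 1 γ ∧ γ 0 = x ∧ γ r = y

/-- Across the gluing point, distances on the line add up, so the triangle inequality through the
common value suffices. -/
theorem LipschitzWith.ite_le {X : Type*} [EMetricSpace X] {g h : ℝ → X}
    (hg : LipschitzWith 1 g) (hh : LipschitzWith 1 h) {T : ℝ} (hT : g T = h T) :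
    LipschitzWith 1 (fun t => if t ≤ T then g t else h t) := by
  have key : ∀ s t : ℝ, s ≤ t → edist (if s ≤ T then g s else h s) (if t ≤ T then g t else h t)
      ≤ edist s t := by
    intro s t hst
    by_cases hs : s ≤ T
    · by_cases ht : t ≤ T
      · simpa [hs, ht] using hg s t
      · have ht' : T ≤ t := (not_le.1 ht).le
        simp only [hs, ht, if_true, if_false]
        calc edist (g s) (h t) ≤ edist (g s) (g T) + edist (h T) (h t) := by
              rw [← hT]; exact edist_triangle _ _ _
          _ ≤ edist s T + edist T t := by
              have h1 := hg s T
              have h2 := hh T t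
              simp only [ENNReal.coe_one, one_mul] at h1 h2
              exact add_le_add h1 h2
          _ = edist s t := by
              rw [edist_dist, edist_dist, edist_dist, ← ENNReal.ofReal_add dist_nonneg dist_nonneg,
                Real.dist_eq, Real.dist_eq, Real.dist_eq, abs_of_nonpos (sub_nonpos.2 hst),
                abs_of_nonpos (sub_nonpos.2 hs), abs_of_nonpos (sub_nonpos.2 ht')]
              congr 1
              ring
    · have ht : ¬ t ≤ T := fun h => hs (hst.trans h)
      simpa [hs, ht] using hh s t
  intro s t
  simp only [ENNReal.coe_one, one_mul]
  rcases le_total s t with h | h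
  · exact key s t h
  · rw [edist_comm, edist_comm s]; exact key t s h

theorem LipschitzWith.comp_one {X Y Z : Type*} [PseudoEMetricSpace X] [PseudoEMetricSpace Y]
    [PseudoEMetricSpace Z] {g : Y → Z} {f : X → Y} (hg : LipschitzWith 1 g)
    (hf : LipschitzWith 1 f) : LipschitzWith 1 (fun x => g (f x)) := by
  have := hg.comp hf
  rwa [mul_one] at this

theorem LipschitzWith.edist_le_one {X Y : Type*} [PseudoEMetricSpace X] [PseudoEMetricSpace Y]
    {f : X → Y} (hf : LipschitzWith 1 f) (x y : X) : edist (f x) (f y) ≤ edist x y := by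
  simpa using hf x y

theorem LipschitzWith.of_edist_le_one {X Y : Type*} [PseudoEMetricSpace X] [PseudoEMetricSpace Y]
    {f : X → Y} (hf : ∀ x y, edist (f x) (f y) ≤ edist x y) : LipschitzWith 1 f := by
  intro x y
  simpa using hf x y

theorem lipschitzWith_one_add_const (c : ℝ) : LipschitzWith 1 (fun t : ℝ => t + c) :=
  LipschitzWith.of_edist_le_one fun x y => by simp

theorem lipschitzWith_one_clamp (r : ℝ) : LipschitzWith 1 (fun t : ℝ => max 0 (min t r)) :=
  (LipschitzWith.id.min_const r).const_max 0

namespace LipJoined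

variable {X Y : Type*} [EMetricSpace X] [EMetricSpace Y]

theorem refl (r : ℝ≥0) (x : X) : LipJoined r x x :=
  ⟨fun _ => x, LipschitzWith.const' x, rfl, rfl⟩

theorem map {f : X → Y} (hf : LipschitzWith 1 f) {r : ℝ≥0} {x y : X} (h : LipJoined r x y) :
    LipJoined r (f x) (f y) := by
  obtain ⟨γ, hγ, rfl, rfl⟩ := h
  exact ⟨fun t => f (γ t), hf.comp_one hγ, rfl, rfl⟩

theorem edist_le {r : ℝ≥0} {x y : X} (h : LipJoined r x y) : edist x y ≤ r := by
  obtain ⟨γ, hγ, rfl, rfl⟩ := h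
  refine (hγ.edist_le_one _ _).trans ?_
  rw [edist_comm, edist_dist, Real.dist_eq, sub_zero, abs_of_nonneg r.coe_nonneg]
  exact ENNReal.ofReal_coe_nnreal.le

theorem symm {r : ℝ≥0} {x y : X} (h : LipJoined r x y) : LipJoined r y x := by
  obtain ⟨γ, hγ, rfl, rfl⟩ := h
  refine ⟨fun t => γ (r - t), hγ.comp_one (LipschitzWith.of_edist_le_one fun s t => ?_), ?_, ?_⟩
  · rw [edist_sub_left]
  · simp
  · simp

/-- Making the curve constant outside `[0, r]` allows gluing with curves defined on the whole line.
-/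
theorem clamped {r : ℝ≥0} {x y : X} (h : LipJoined r x y) :
    ∃ γ : ℝ → X, LipschitzWith 1 γ ∧ (∀ t ≤ 0, γ t = x) ∧ ∀ t, (r : ℝ) ≤ t → γ t = y := by
  obtain ⟨γ, hγ, rfl, rfl⟩ := h
  refine ⟨fun t => γ (max 0 (min t r)), hγ.comp_one (lipschitzWith_one_clamp r),
    fun t ht => ?_, fun t ht => ?_⟩
  · simp [max_eq_left ((min_le_left t (r : ℝ)).trans ht)]
  · simp [min_eq_right ht]

theorem trans {r s : ℝ≥0} {x y z : X} (h : LipJoined r x y) (h' : LipJoined s y z) :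
    LipJoined (r + s) x z := by
  obtain ⟨γ, hγ, h0, h1⟩ := h.clamped
  obtain ⟨δ, hδ, k0, k1⟩ := h'.clamped
  have hδ' := hδ.comp_one (lipschitzWith_one_add_const (-(r : ℝ)))
  refine ⟨_, hγ.ite_le hδ' (T := r) ?_, ?_, ?_⟩
  · simp [h1 r le_rfl, k0 0 le_rfl]
  · simp [h0 0 le_rfl]
  · by_cases hs : ((r + s : ℝ≥0) : ℝ) ≤ r
    -- Degenerate case `s = 0`: the second curve is a point, so `y = z`.
    · have hs0 : (s : ℝ) ≤ 0 := by push_cast at hs; linarith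
      simp only [hs, if_true]
      rw [h1 _ (by simp), ← k1 0 hs0, k0 0 le_rfl]
    · simp only [hs, if_false]
      exact k1 _ (by simp)

theorem mono {r s : ℝ≥0} (hrs : r ≤ s) {x y : X} (h : LipJoined r x y) : LipJoined s x y := by
  have := h.trans (refl (s - r) y)
  rwa [add_tsub_cancel_of_le hrs] at this

/-- Infinitely many curves of summable lengths can be concatenated, if the limit point exists. -/
theorem of_hasSum {u : ℕ → X} {r : ℕ → ℝ≥0} {S : ℝ≥0} {x : X} (hr : HasSum r S)
    (hu : ∀ n, LipJoined (r n) (u n) (u (n + 1)))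
    (hx : Filter.Tendsto u Filter.atTop (nhds x)) : LipJoined S (u 0) x := by
  choose γ hγ h0 h1 using fun n => (hu n).clamped
  let T : ℕ → ℝ := fun n => ∑ i ∈ Finset.range n, (r i : ℝ)
  have hTs : ∀ n, T (n + 1) = T n + r n := fun n => Finset.sum_range_succ _ _
  -- `g n` runs through the first `n` curves and rests at `u n` from time `T n` on.
  let g : ℕ → ℝ → X := fun n => n.rec (fun _ => u 0)
    (fun n gn t => if t ≤ T n then gn t else γ n (t + -T n))
  have gs : ∀ n t, g (n + 1) t = if t ≤ T n then g n t else γ n (t + -T n) := fun _ _ => rfl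
  have hg : ∀ n, LipschitzWith 1 (g n) ∧ ∀ t, T n ≤ t → g n t = u n := by
    intro n
    induction n with
    | zero => exact ⟨LipschitzWith.const' _, fun _ _ => rfl⟩
    | succ n ih =>
      refine ⟨ih.1.ite_le ((hγ n).comp_one (lipschitzWith_one_add_const (-T n))) ?_,
        fun t ht => ?_⟩
      · rw [ih.2 _ le_rfl, h0 n _ (by simp)]
      · rw [hTs] at ht
        rw [gs]
        split_ifs with h
        · have hr0 : (r n : ℝ) ≤ 0 := by linarith
          have : t = T n := le_antisymm h (by linarith [(r n).2])
          rw [ih.2 t this.ge, ← h0 n 0 le_rfl, h1 n 0 hr0]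
        · exact h1 n _ (by linarith)
  have hTmono : Monotone T := monotone_nat_of_le_succ fun n => by rw [hTs]; simp
  have hTlim : Filter.Tendsto T Filter.atTop (nhds S) := by
    have := (NNReal.hasSum_coe.2 hr).tendsto_sum_nat
    exact this
  have hTS : ∀ n, T n ≤ S := hTmono.ge_of_tendsto hTlim
  -- Before time `S` the sequence is eventually constant; from `S` on it is `u` itself, which tends
  -- to `x`.
  have hlim : ∀ t, ∃ y, Filter.Tendsto (fun n => g n t) Filter.atTop (nhds y) := by
    intro t
    rcases lt_or_ge t S with ht | ht
    · obtain ⟨N, hN⟩ := (hTlim.eventually (lt_mem_nhds ht)).exists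
      refine ⟨g N t, tendsto_const_nhds.congr' ?_⟩
      filter_upwards [Filter.eventually_ge_atTop N] with n hn
      induction n, hn using Nat.le_induction with
      | base => rfl
      | succ n hn ih => rw [gs, if_pos (hN.le.trans (hTmono hn)), ih]
    · refine ⟨x, hx.congr fun n => ?_⟩
      rw [(hg n).2 t ((hTS n).trans ht)]
  choose G hG using hlim
  refine ⟨G, LipschitzWith.of_edist_le_one fun s t => ?_, ?_, ?_⟩
  · exact le_of_tendsto' ((hG s).edist (hG t)) fun n => (hg n).1.edist_le_one s t
  · refine tendsto_nhds_unique (hG 0) (tendsto_const_nhds.congr fun n => ?_)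
    induction n with
    | zero => rfl
    | succ n ih => 
      have h0T : (0 : ℝ) ≤ T n := Finset.sum_nonneg fun i _ => (r i).coe_nonneg
      rw [gs, if_pos h0T, ih]
  · exact tendsto_nhds_unique (hG S) (hx.congr fun n => ((hg n).2 S (hTS n)).symm)

end LipJoined

/-! ### Arc length -/

/-- Parametrization by arc length of a rectifiable continuous curve. -/
theorem lipJoined_of_continuousOn {X : Type*} [EMetricSpace X] {a b : ℝ} (hab : a ≤ b)
    {γ : ℝ → X} (hγ : ContinuousOn γ (Set.Icc a b)) {L : ℝ≥0}
    (hL : eVariationOn γ (Set.Icc a b) = L) : LipJoined L (γ a) (γ b) := by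
  have hbv : BoundedVariationOn γ (Set.Icc a b) := by
    rw [BoundedVariationOn, hL]; exact ENNReal.coe_ne_top
  -- Arc length from `a`. It is continuous because `γ` is, so it takes all values in `[0, L]`, and
  -- `τ` below is a possibly discontinuous right inverse.
  let V : ℝ → ℝ≥0∞ := fun t => eVariationOn γ (Set.Icc a b ∩ Set.Icc a t)
  have hVadd : ∀ s ∈ Set.Icc a b, ∀ t, s ≤ t →
      V s + eVariationOn γ (Set.Icc a b ∩ Set.Icc s t) = V t := fun s hs t hst =>
    eVariationOn.Icc_add_Icc γ hs.1 hst hs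
  have hVtop : ∀ t, V t ≠ ∞ := fun t => hbv.mono Set.inter_subset_left
  have hVa : V a = 0 := by
    refine eVariationOn.subsingleton _ fun x hx y hy => ?_
    exact (le_antisymm hx.2.2 hx.2.1).trans (le_antisymm hy.2.2 hy.2.1).symm
  have hVb : V b = L := by
    simp only [V, Set.inter_self, hL]
  have hVc : ContinuousOn V (Set.Icc a b) := by
    intro x hx
    have hR : Filter.Tendsto V (nhdsWithin x (Set.Icc a b ∩ Set.Ici x)) (nhds (V x)) := by
      have h := (hbv.tendsto_eVariationOn_Icc_zero_right x
        ((hγ x hx).mono Set.inter_subset_left)).mono_left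
          (nhdsWithin_mono x (Set.inter_subset_left (t := Set.Ici x)))
      have h' := (tendsto_const_nhds (x := V x)).add h
      rw [add_zero] at h'
      refine h'.congr' ?_
      filter_upwards [self_mem_nhdsWithin] with y hy using hVadd x hx y hy.2
    have hLft : Filter.Tendsto V (nhdsWithin x (Set.Icc a b ∩ Set.Iic x)) (nhds (V x)) := by
      have h := (hbv.tendsto_eVariationOn_Icc_zero_left (x := x)
        ((hγ x hx).mono Set.inter_subset_left)).mono_left
          (nhdsWithin_mono x (Set.inter_subset_left (t := Set.Iic x)))
      have h' := ENNReal.Tendsto.sub (tendsto_const_nhds (x := V x)) h (Or.inl (hVtop x))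
      rw [tsub_zero] at h'
      refine h'.congr' ?_
      filter_upwards [self_mem_nhdsWithin] with y hy
      rw [← hVadd y hy.1 x hy.2]
      refine ENNReal.add_sub_cancel_right ?_
      exact hbv.mono Set.inter_subset_left
    have : Set.Icc a b = (Set.Icc a b ∩ Set.Iic x) ∪ (Set.Icc a b ∩ Set.Ici x) := by
      rw [← Set.inter_union_distrib_left, Set.Iic_union_Ici, Set.inter_univ]
    unfold ContinuousWithinAt
    rw [this, nhdsWithin_union]
    exact hLft.sup hR
  have hsurj : ∀ r : ℝ, ∃ t ∈ Set.Icc a b, V t = ENNReal.ofReal (max 0 (min r L)) := by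
    intro r
    refine intermediate_value_Icc hab hVc ⟨by simp [hVa], ?_⟩
    rw [hVb]
    exact ENNReal.ofReal_le_of_le_toReal (by simp)
  choose τ hτ hVτ using hsurj
  have key : ∀ s ∈ Set.Icc a b, ∀ t ∈ Set.Icc a b, s ≤ t →
      edist (γ s) (γ t) ≤ V t - V s := by
    intro s hs t ht hst
    rw [← hVadd s hs t hst, ENNReal.add_sub_cancel_left (hVtop s)]
    exact eVariationOn.edist_le γ ⟨hs, le_rfl, hst⟩ ⟨ht, hst, le_rfl⟩
  -- One of the two truncated differences vanishes; their sum is the absolute difference.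
  have key' : ∀ s ∈ Set.Icc a b, ∀ t ∈ Set.Icc a b,
      edist (γ s) (γ t) ≤ (V t - V s) + (V s - V t) := by
    intro s hs t ht
    rcases le_total s t with h | h
    · exact (key s hs t ht h).trans le_self_add
    · rw [edist_comm]
      exact (key t ht s hs h).trans le_add_self
  -- Needed at the endpoints: `τ 0` need not be `a`, nor `τ L` be `b`.
  have heq : ∀ s ∈ Set.Icc a b, ∀ t ∈ Set.Icc a b, V s = V t → γ s = γ t := by
    intro s hs t ht h
    have := key' s hs t ht
    rw [h, tsub_self, add_zero] at this
    exact edist_le_zero.1 this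
  refine ⟨fun r => γ (τ r), LipschitzWith.of_edist_le_one fun r r' => ?_, ?_, ?_⟩
  · refine (key' _ (hτ r) _ (hτ r')).trans ?_
    rw [hVτ, hVτ]
    refine le_trans ?_ ((lipschitzWith_one_clamp L).edist_le_one r r')
    set p := max 0 (min r (L : ℝ))
    set q := max 0 (min r' (L : ℝ))
    have hp : 0 ≤ p := le_max_left _ _
    have hq : 0 ≤ q := le_max_left _ _
    rw [← ENNReal.ofReal_sub _ hp, ← ENNReal.ofReal_sub _ hq, edist_dist, Real.dist_eq]
    rcases le_total p q with h | h
    · rw [ENNReal.ofReal_of_nonpos (sub_nonpos.2 h), add_zero, abs_sub_comm,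
        abs_of_nonneg (sub_nonneg.2 h)]
    · rw [ENNReal.ofReal_of_nonpos (sub_nonpos.2 h), zero_add, abs_of_nonneg (sub_nonneg.2 h)]
  · refine heq _ (hτ _) _ (Set.left_mem_Icc.2 hab) ?_
    rw [hVτ, hVa]; simp
  · refine heq _ (hτ _) _ (Set.right_mem_Icc.2 hab) ?_
    rw [hVτ, hVb]; simp

/-- The inequality is strict because the infimum of lengths need not be attained; a shorter curve is
padded by a constant one. -/
theorem isPathMetric_iff_lipJoined {X : Type*} [EMetricSpace X] :
    IsPathMetric X ↔ ∀ (x y : X) (r : ℝ≥0), edist x y < r → LipJoined r x y := by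
  constructor
  · intro h x y r hr
    rw [h x y, pathEDist, sInf_lt_iff] at hr
    obtain ⟨_, ⟨a, b, γ, hab, hγ, rfl, rfl, rfl⟩, hlt⟩ := hr
    have hne : eVariationOn γ (Set.Icc a b) ≠ ∞ := (hlt.trans ENNReal.coe_lt_top).ne
    refine (lipJoined_of_continuousOn hab hγ (ENNReal.coe_toNNReal hne).symm).mono ?_
    exact ENNReal.coe_le_coe.1 ((ENNReal.coe_toNNReal hne).le.trans hlt.le)
  · intro h x y
    refine le_antisymm (le_pathEDist x y) (le_of_forall_gt fun c hc => ?_)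
    obtain ⟨r, hr, hrc⟩ := ENNReal.lt_iff_exists_nnreal_btwn.1 hc
    obtain ⟨γ, hγ, rfl, rfl⟩ := h x y r hr
    refine lt_of_le_of_lt (pathEDist_le_of_lipschitz r.coe_nonneg hγ) ?_
    rwa [sub_zero, ENNReal.ofReal_coe_nnreal]

/-! ### The intrinsic metric -/

/-- The space `X` with its intrinsic metric. -/
@[ext]
structure Pathify (X : Type*) where
  val : X

namespace Pathify

variable {X Y : Type*} [EMetricSpace X] [EMetricSpace Y]

noncomputable instance : EDist (Pathify X) where
  edist x y := ⨅ (r : ℝ≥0) (_ : LipJoined r x.val y.val), (r : ℝ≥0∞)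

theorem edist_def (x y : Pathify X) :
    edist x y = ⨅ (r : ℝ≥0) (_ : LipJoined r x.val y.val), (r : ℝ≥0∞) :=
  rfl

theorem edist_lt_iff {x y : Pathify X} {c : ℝ≥0∞} :
    edist x y < c ↔ ∃ r : ℝ≥0, LipJoined r x.val y.val ∧ (r : ℝ≥0∞) < c := by
  simp only [edist_def, iInf_lt_iff, exists_prop]

theorem edist_le {r : ℝ≥0} {x y : Pathify X} (h : LipJoined r x.val y.val) : edist x y ≤ r :=
  iInf₂_le r h

theorem le_edist (x y : Pathify X) : edist x.val y.val ≤ edist x y :=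
  le_iInf₂ fun _ h => h.edist_le

noncomputable instance : EMetricSpace (Pathify X) where
  edist_self x := le_antisymm (edist_le (LipJoined.refl 0 x.val)) zero_le
  edist_comm x y := le_antisymm
    (le_iInf₂ fun _ h => edist_le h.symm) (le_iInf₂ fun _ h => edist_le h.symm)
  edist_triangle x y z := by
    rw [edist_def x y, edist_def y z]
    simp only [ENNReal.iInf_add, ENNReal.add_iInf]
    refine le_iInf₂ fun r hr => le_iInf₂ fun s hs => ?_
    exact (edist_le (hs.trans hr)).trans_eq (ENNReal.coe_add _ _)
  eq_of_edist_eq_zero {x y} h :=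
    Pathify.ext (edist_le_zero.1 ((le_edist x y).trans h.le))

theorem lipschitz_val : LipschitzWith 1 (val : Pathify X → X) :=
  LipschitzWith.of_edist_le_one le_edist

/-- The universal property of the coreflection: `f` carries curves of `Y` to curves of `X` that are
no longer. -/
theorem lipschitz_mk (hY : IsPathMetric Y) {f : Y → X} (hf : LipschitzWith 1 f) :
    LipschitzWith 1 (fun y => (⟨f y⟩ : Pathify X)) := by
  refine LipschitzWith.of_edist_le_one fun x y => le_of_forall_gt fun c hc => ?_
  obtain ⟨r, hr, hrc⟩ := ENNReal.lt_iff_exists_nnreal_btwn.1 hc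
  exact (edist_le ((isPathMetric_iff_lipJoined.1 hY x y r hr).map hf)).trans_lt hrc

/-- The same curve works: its piece between times `s` and `t` bounds the intrinsic distance by `|t -
s|`. -/
theorem lipJoined {r : ℝ≥0} {x y : Pathify X} (h : LipJoined r x.val y.val) :
    LipJoined r x y := by
  obtain ⟨γ, hγ, h0, h1⟩ := h
  refine ⟨fun t => ⟨γ t⟩, LipschitzWith.of_edist_le_one ?_, Pathify.ext h0, Pathify.ext h1⟩
  have key : ∀ s t : ℝ, s ≤ t → edist (⟨γ s⟩ : Pathify X) ⟨γ t⟩ ≤ edist s t := by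
    intro s t hst
    have : LipJoined (t - s).toNNReal (γ s) (γ t) :=
      ⟨fun v => γ (v + s), hγ.comp_one (lipschitzWith_one_add_const s), by simp, by
        simp [hst]⟩
    refine (edist_le this).trans ?_
    rw [edist_comm, edist_dist, Real.dist_eq, abs_of_nonneg (sub_nonneg.2 hst)]
    exact le_rfl
  intro s t
  rcases le_total s t with h | h
  · exact key s t h
  · rw [edist_comm, edist_comm s]; exact key t s h

theorem isPathMetric : IsPathMetric (Pathify X) := by
  refine isPathMetric_iff_lipJoined.2 fun x y r hr => ?_
  obtain ⟨s, hs, hsr⟩ := edist_lt_iff.1 hr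
  exact (lipJoined hs).mono (ENNReal.coe_le_coe.1 hsr.le)

/-- A fast Cauchy sequence converges in `X`, and concatenating the curves from index `N` on reaches
the limit within length `∑_{n ≥ N} 2⁻ⁿ = 2 · 2⁻ᴺ`, so convergence is intrinsic. -/
instance [CompleteSpace X] : CompleteSpace (Pathify X) := by
  refine EMetric.complete_of_convergent_controlled_sequences
    (fun n => (((1 / 2 : ℝ≥0) ^ n : ℝ≥0) : ℝ≥0∞)) (fun n => by simp) fun u hu => ?_
  have hj : ∀ n, LipJoined ((1 / 2 : ℝ≥0) ^ n) (u n).val (u (n + 1)).val := fun n => by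
    obtain ⟨s, hs, hsr⟩ := edist_lt_iff.1 (hu n n (n + 1) le_rfl n.le_succ)
    exact hs.mono (ENNReal.coe_le_coe.1 hsr.le)
  have hc : CauchySeq (fun n => (u n).val) := by
    refine cauchySeq_of_edist_le_geometric_two 1 ENNReal.one_ne_top fun n => ?_
    refine (hj n).edist_le.trans_eq ?_
    rw [ENNReal.coe_pow, ENNReal.coe_div two_ne_zero]
    simp [ENNReal.inv_pow]
  obtain ⟨x, hx⟩ := cauchySeq_tendsto_of_complete hc
  have hlim : ∀ N, LipJoined (2 * (1 / 2 : ℝ≥0) ^ N) (u N).val x := by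
    intro N
    have hs : HasSum (fun n => (1 / 2 : ℝ≥0) ^ (n + N)) (2 * (1 / 2 : ℝ≥0) ^ N) := by
      have h2 : HasSum (fun n : ℕ => (1 / 2 : ℝ≥0) ^ n) 2 := by
        rw [← NNReal.hasSum_coe]
        simpa using hasSum_geometric_two
      simpa [pow_add] using h2.mul_right ((1 / 2 : ℝ≥0) ^ N)
    have := LipJoined.of_hasSum (u := fun n => (u (n + N)).val) hs
      (fun n => by simpa [add_right_comm] using hj (n + N))
      ((Filter.tendsto_add_atTop_iff_nat N).2 hx)
    simpa using this
  refine ⟨⟨x⟩, tendsto_iff_edist_tendsto_0.2 ?_⟩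
  have h0 : Filter.Tendsto (fun N : ℕ => ((2 * (1 / 2 : ℝ≥0) ^ N : ℝ≥0) : ℝ≥0∞)) Filter.atTop
      (nhds 0) := by
    have h := (tendsto_pow_atTop_nhds_zero_of_lt_one (r := (1 / 2 : ℝ≥0)) zero_le
      (by norm_num)).const_mul 2
    rw [mul_zero] at h
    exact ENNReal.tendsto_coe.2 h
  exact tendsto_of_tendsto_of_tendsto_of_le_of_le tendsto_const_nhds h0 (fun _ => zero_le)
    fun N => edist_le (hlim N)

end Pathify

/-! ### Extension and completion -/

/-- Non-expansive maps to a complete space extend from dense subsets. -/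
theorem LipschitzWith.exists_extend {X Y Z : Type*} [PseudoEMetricSpace Z]
    [EMetricSpace Y] [CompleteSpace Y] {i : X → Z} (hd : DenseRange i)
    {f : X → Y} (hf : ∀ x y, edist (f x) (f y) ≤ edist (i x) (i y)) :
    ∃ g : Z → Y, LipschitzWith 1 g ∧ ∀ x, g (i x) = f x := by
  let _ : PseudoEMetricSpace X := PseudoEMetricSpace.induced i inferInstance
  have hi : Isometry i := fun _ _ => rfl
  have hf' : LipschitzWith 1 f := LipschitzWith.of_edist_le_one hf
  let g := (hi.isUniformInducing.isDenseInducing hd).extend f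
  have hg : Continuous g :=
    (uniformContinuous_uniformly_extend hi.isUniformInducing hd hf'.uniformContinuous).continuous
  have hgi : ∀ x, g (i x) = f x :=
    uniformly_extend_of_ind hi.isUniformInducing hd hf'.uniformContinuous
  refine ⟨g, LipschitzWith.of_edist_le_one fun a b => ?_, hgi⟩
  refine hd.induction_on₂ (p := fun a b => edist (g a) (g b) ≤ edist a b) ?_ ?_ a b
  · exact isClosed_le ((hg.comp continuous_fst).edist (hg.comp continuous_snd))
      (continuous_fst.edist continuous_snd)
  · intro x y
    rw [hgi, hgi]
    exact hf x y

/-- The completion of a space with possibly infinite distances: a point is given by its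
distances to the points of `X`. -/
@[ext]
structure ECompletion (X : Type*) [PseudoEMetricSpace X] where
  toFun : X → ℝ≥0∞
  le_add : ∀ x y, toFun x ≤ edist x y + toFun y
  edist_le : ∀ x y, edist x y ≤ toFun x + toFun y
  iInf_eq : ⨅ x, toFun x = 0

namespace ECompletion

variable {X : Type*} [PseudoEMetricSpace X]

theorem exists_lt (f : ECompletion X) {ε : ℝ≥0∞} (hε : 0 < ε) : ∃ x, f.toFun x < ε := by
  rw [← f.iInf_eq] at hε
  exact iInf_lt_iff.1 hε

noncomputable instance : EMetricSpace (ECompletion X) where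
  edist f g := ⨅ x, (f.toFun x + g.toFun x)
  edist_self f := by
    refine le_antisymm (le_of_forall_gt fun c hc => ?_) zero_le
    obtain ⟨x, hx⟩ := f.exists_lt (ENNReal.half_pos hc.ne')
    exact iInf_lt_iff.2 ⟨x, (ENNReal.add_lt_add hx hx).trans_eq (ENNReal.add_halves c)⟩
  edist_comm f g := by simp only [add_comm]
  edist_triangle f g h := by
    simp only [ENNReal.iInf_add, ENNReal.add_iInf]
    refine le_iInf fun y => le_iInf fun x => (iInf_le _ x).trans ?_
    calc f.toFun x + h.toFun x ≤ f.toFun x + (edist x y + h.toFun y) := by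
          gcongr; exact h.le_add x y
      _ ≤ f.toFun x + ((g.toFun x + g.toFun y) + h.toFun y) := by
          gcongr; exact g.edist_le x y
      _ = _ := by ring
  eq_of_edist_eq_zero {f g} hfg := by
    have key : ∀ f g : ECompletion X, ⨅ x, (f.toFun x + g.toFun x) = 0 →
        ∀ z, f.toFun z ≤ g.toFun z := by
      intro f g h z
      have : f.toFun z ≤ (⨅ x, (f.toFun x + g.toFun x)) + g.toFun z := by
        rw [ENNReal.iInf_add]
        refine le_iInf fun x => (f.le_add z x).trans ?_
        calc edist z x + f.toFun x ≤ (g.toFun z + g.toFun x) + f.toFun x := by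
              gcongr; exact g.edist_le z x
          _ = _ := by ring
      rwa [h, zero_add] at this
    refine ECompletion.ext (funext fun z => le_antisymm (key f g hfg z) (key g f ?_ z))
    simpa only [add_comm] using hfg

theorem edist_def (f g : ECompletion X) : edist f g = ⨅ x, (f.toFun x + g.toFun x) :=
  rfl

/-- The inclusion of `X` into its completion. -/
def of (x : X) : ECompletion X where
  toFun y := edist y x
  le_add y z := edist_triangle y z x
  edist_le y z := (edist_triangle y x z).trans_eq (by rw [edist_comm x z])
  iInf_eq := le_antisymm ((iInf_le _ x).trans_eq (edist_self x)) zero_le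

theorem edist_of (f : ECompletion X) (x : X) : edist f (of x) = f.toFun x := by
  refine le_antisymm ((iInf_le _ x).trans_eq (by simp [of])) (le_iInf fun y => ?_)
  exact (f.le_add x y).trans_eq (by rw [add_comm, edist_comm]; rfl)

theorem isometry_of : Isometry (of : X → ECompletion X) := fun x y => by
  rw [edist_of]; exact edist_comm y x

theorem denseRange_of : DenseRange (of : X → ECompletion X) := by
  intro f
  refine EMetric.mem_closure_iff.2 fun ε hε => ?_
  obtain ⟨x, hx⟩ := f.exists_lt hε
  exact ⟨of x, ⟨x, rfl⟩, by rwa [edist_of]⟩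

instance : CompleteSpace (ECompletion X) := by
  refine completeSpace_extension isometry_of.isUniformInducing denseRange_of fun F hF => ?_
  have := hF.1
  -- The distance to the missing limit; by `key` it is uniformly approximated by the distance to any
  -- point of a small member of `F`.
  let φ : X → ℝ≥0∞ := fun z => Filter.limsup (fun y => edist z y) F
  have key : ∀ ε : ℝ≥0∞, 0 < ε → ∃ S ∈ F, ∀ y ∈ S, ∀ z, φ z ≤ edist z y + ε ∧
      edist z y ≤ φ z + ε := by
    intro ε hε
    obtain ⟨-, h⟩ := EMetric.cauchy_iff.1 hF
    obtain ⟨S, hS, h⟩ := h ε hε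
    refine ⟨S, hS, fun y hy z => ⟨?_, ?_⟩⟩
    · refine Filter.limsup_le_of_le (by isBoundedDefault) ?_
      filter_upwards [hS] with w hw
      exact (edist_triangle z y w).trans (by gcongr; exact (h y hy w hw).le)
    · rw [← tsub_le_iff_right]
      refine Filter.le_limsup_of_frequently_le ?_ (by isBoundedDefault)
      refine Filter.Eventually.frequently ?_
      filter_upwards [hS] with w hw
      rw [tsub_le_iff_right]
      exact (edist_triangle z w y).trans (by gcongr; exact (h w hw y hy).le)
  have key' : ∀ ε : ℝ≥0∞, 0 < ε → ∃ y, ∀ z, φ z ≤ edist z y + ε ∧ edist z y ≤ φ z + ε := by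
    intro ε hε
    obtain ⟨S, hS, h⟩ := key ε hε
    obtain ⟨y, hy⟩ := hF.1.nonempty_of_mem hS
    exact ⟨y, h y hy⟩
  have hε2 : ∀ ε : ℝ≥0, 0 < ε → (0 : ℝ≥0∞) < ε / 2 := fun ε hε =>
    ENNReal.half_pos (by exact_mod_cast hε.ne')
  let f : ECompletion X :=
    { toFun := φ
      le_add := fun x y => by
        refine ENNReal.le_of_forall_pos_le_add fun ε hε _ => ?_
        obtain ⟨w, hw⟩ := key' _ (hε2 ε hε)
        calc φ x ≤ edist x w + ε / 2 := (hw x).1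
          _ ≤ edist x y + (φ y + ε / 2) + ε / 2 := by
            gcongr
            exact (edist_triangle x y w).trans (by gcongr; exact (hw y).2)
          _ = edist x y + φ y + ε := by
            rw [← add_assoc, add_assoc (edist x y + φ y), ENNReal.add_halves]
      edist_le := fun x y => by
        refine ENNReal.le_of_forall_pos_le_add fun ε hε _ => ?_
        obtain ⟨w, hw⟩ := key' _ (hε2 ε hε)
        calc edist x y ≤ edist x w + edist y w := edist_triangle_right x y w
          _ ≤ (φ x + ε / 2) + (φ y + ε / 2) := add_le_add (hw x).2 (hw y).2
          _ = φ x + φ y + ε := by rw [add_add_add_comm, ENNReal.add_halves]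
      iInf_eq := by
        refine le_antisymm (ENNReal.le_of_forall_pos_le_add fun ε hε _ => ?_) zero_le
        obtain ⟨w, hw⟩ := key' ε (by exact_mod_cast hε)
        refine (iInf_le _ w).trans ?_
        simpa using (hw w).1 }
  refine ⟨f, ?_⟩
  rw [Filter.map_le_iff_le_comap, ← Filter.tendsto_iff_comap, EMetric.tendsto_nhds]
  intro ε hε
  obtain ⟨δ, hδ, hδε⟩ := exists_between hε
  obtain ⟨S, hS, h⟩ := key δ hδ
  filter_upwards [hS] with y hy
  rw [edist_comm, edist_of]
  refine lt_of_le_of_lt ?_ hδε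
  simpa using (h y hy y).1

end ECompletion

/-! ### Colimits in `CMet` -/

namespace CMet

variable {J : Type u} [Category.{u} J]

/-- A non-expansive map as a morphism. -/
def homMk {X Y : CMet.{u}} (f : X → Y) (hf : LipschitzWith 1 f) : X ⟶ Y :=
  (⟨f, hf⟩ : Hom X Y)

theorem lipschitz_hom {X Y : CMet.{u}} (f : X ⟶ Y) : LipschitzWith 1 f :=
  Hom.lipschitz f

theorem edist_map_le {X Y : CMet.{u}} (f : X ⟶ Y) (x y : X) :
    edist (f x) (f y) ≤ edist x y :=
  (lipschitz_hom f).edist_le_one x y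

theorem hom_ext {X Y : CMet.{u}} {f g : X ⟶ Y} (h : ∀ x, f x = g x) : f = g :=
  ConcreteCategory.hom_ext _ _ h

/-- The points of the objects of a diagram. -/
structure DiagramPt (F : J ⥤ CMet.{u}) : Type u where
  idx : J
  pt : F.obj idx

/-- The legs of a cocone as maps. -/
def leg {F : J ⥤ CMet.{u}} (c : Cocone F) {j : J} (x : F.obj j) : c.pt :=
  (c.ι.app j : F.obj j ⟶ c.pt) x

theorem leg_map {F : J ⥤ CMet.{u}} (c : Cocone F) {j k : J} (f : j ⟶ k) (x : F.obj j) :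
    leg c (F.map f x) = leg c x :=
  ConcreteCategory.congr_hom (c.w f) x

theorem edist_leg_le {F : J ⥤ CMet.{u}} (c : Cocone F) {j : J} (x y : F.obj j) :
    edist (leg c x) (leg c y) ≤ edist x y :=
  edist_map_le (c.ι.app j : F.obj j ⟶ c.pt) x y

section

variable (F : J ⥤ CMet.{u}) [PseudoEMetricSpace (DiagramPt F)]
  (h₁ : ∀ (j : J) (x y : F.obj j), edist (DiagramPt.mk j x) ⟨j, y⟩ ≤ edist x y)
  (h₂ : ∀ (j k : J) (f : j ⟶ k) (x : F.obj j), edist (DiagramPt.mk j x) ⟨k, F.map f x⟩ = 0)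

/-- The cocone obtained by completing a compatible pseudometric on the points of a diagram. -/
noncomputable def completionCocone : Cocone F where
  pt := { carrier := ECompletion (DiagramPt F) }
  ι :=
    { app := fun j => homMk (fun x => ECompletion.of ⟨j, x⟩)
        (LipschitzWith.of_edist_le_one fun x y => by
          rw [ECompletion.isometry_of]; exact h₁ j x y)
      naturality := fun j k f => hom_ext fun x => edist_le_zero.1 (by
        change edist (ECompletion.of (DiagramPt.mk k (F.map f x)))
          (ECompletion.of (DiagramPt.mk j x)) ≤ 0
        rw [ECompletion.isometry_of, edist_comm, h₂ j k f x]) }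

theorem edist_leg_completionCocone {j k : J} (x : F.obj j) (y : F.obj k) :
    edist (leg (completionCocone F h₁ h₂) x) (leg (completionCocone F h₁ h₂) y) =
      edist (DiagramPt.mk j x) ⟨k, y⟩ :=
  ECompletion.isometry_of _ _

/-- If the pseudometric is the largest compatible one, the completion is a colimit. -/
noncomputable def isColimitCompletionCocone
    (h : ∀ (c : Cocone F) (j k : J) (x : F.obj j) (y : F.obj k),
      edist (leg c x) (leg c y) ≤ edist (DiagramPt.mk j x) ⟨k, y⟩) :
    IsColimit (completionCocone F h₁ h₂) := by
  have hex : ∀ c : Cocone F, ∃ g : ECompletion (DiagramPt F) → c.pt, LipschitzWith 1 g ∧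
      ∀ z : DiagramPt F, g (ECompletion.of z) = leg c z.pt := fun c =>
    LipschitzWith.exists_extend (f := fun z : DiagramPt F => leg c z.pt)
      ECompletion.denseRange_of fun x y =>
        (h c x.idx y.idx x.pt y.pt).trans_eq (ECompletion.isometry_of x y).symm
  choose g hg hgof using hex
  exact
    { desc := fun c => homMk (X := (completionCocone F h₁ h₂).pt) (g c) (hg c)
      fac := fun c j => hom_ext fun x => hgof c ⟨j, x⟩
      uniq := fun c m hm => hom_ext fun x => by
        refine congrFun (ECompletion.denseRange_of.equalizer
          (lipschitz_hom m).continuous (hg c).continuous (funext fun z => ?_)) x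
        exact (ConcreteCategory.congr_hom (hm z.idx) z.pt).trans (hgof c z).symm }

end

instance : HasColimitsOfSize.{u, u} CMet.{u} where
  has_colimits_of_shape J _ :=
    { has_colimit := fun F => by
        -- The largest compatible pseudometric. The cocones form a large type, but the supremum is
        -- taken in `ℝ≥0∞`.
        let _ : PseudoEMetricSpace (DiagramPt F) :=
          { edist := fun x y => ⨆ c : Cocone F, edist (leg c x.pt) (leg c y.pt)
            edist_self := fun x => by simp
            edist_comm := fun x y => by simp only [edist_comm]
            edist_triangle := fun x y z => iSup_le fun c =>
              (edist_triangle _ (leg c y.pt) _).trans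
                (add_le_add (le_iSup (fun c : Cocone F => edist (leg c x.pt) (leg c y.pt)) c)
                  (le_iSup (fun c : Cocone F => edist (leg c y.pt) (leg c z.pt)) c)) }
        have h₁ : ∀ (j : J) (x y : F.obj j),
            edist (DiagramPt.mk (F := F) j x) ⟨j, y⟩ ≤ edist x y := fun j x y =>
          iSup_le fun c => edist_leg_le c x y
        have h₂ : ∀ (j k : J) (f : j ⟶ k) (x : F.obj j),
            edist (DiagramPt.mk (F := F) j x) ⟨k, F.map f x⟩ = 0 := fun j k f x =>
          le_antisymm (iSup_le fun c => by rw [leg_map, edist_self]) zero_le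
        exact ⟨⟨_, isColimitCompletionCocone F h₁ h₂ fun c j k x y =>
          le_iSup (fun c : Cocone F => edist (leg c x) (leg c y)) c⟩⟩ }

end CMet

/-! ### Coreflectivity and colimits of path metric spaces -/

namespace CPMet

/-- The inclusion of path metric spaces into metric spaces. -/
abbrev incl : CPMet.{u} ⥤ CMet.{u} :=
  ObjectProperty.ι _

/-- A non-expansive map as a morphism. -/
def homMk {X Y : CPMet.{u}} (f : X.obj → Y.obj) (hf : LipschitzWith 1 f) : X ⟶ Y :=
  ObjectProperty.homMk (CMet.homMk f hf)

@[simp]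
theorem homMk_apply {X Y : CPMet.{u}} (f : X.obj → Y.obj) (hf : LipschitzWith 1 f) (x : X.obj) :
    homMk f hf x = f x :=
  rfl

theorem lipschitz_hom {X Y : CPMet.{u}} (f : X ⟶ Y) : LipschitzWith 1 f :=
  CMet.lipschitz_hom f.hom

theorem hom_ext {X Y : CPMet.{u}} {f g : X ⟶ Y} (h : ∀ x, f x = g x) : f = g :=
  ConcreteCategory.hom_ext _ _ h

/-- The intrinsic metric, as a complete path metric space. -/
noncomputable def pathify (X : CMet.{u}) : CPMet.{u} where
  obj := { carrier := Pathify X }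
  property := Pathify.isPathMetric

/-- Non-expansive maps from a path metric space are non-expansive for the intrinsic metric. -/
noncomputable def pathifyEquiv (X : CPMet.{u}) (Y : CMet.{u}) :
    (incl.obj X ⟶ Y) ≃ (X ⟶ pathify Y) where
  toFun f := homMk (Y := pathify Y) (fun x => ⟨f x⟩)
    (Pathify.lipschitz_mk X.property (CMet.lipschitz_hom f))
  invFun g := CMet.homMk (fun x => (g x : Pathify Y).val)
    (Pathify.lipschitz_val.comp_one (lipschitz_hom g))
  left_inv _ := rfl
  right_inv _ := rfl

noncomputable instance : Coreflective incl.{u} where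
  R := Adjunction.rightAdjointOfEquiv pathifyEquiv fun _ _ _ _ _ => rfl
  adj := Adjunction.adjunctionOfEquivRight pathifyEquiv fun _ _ _ _ _ => rfl

instance : HasColimitsOfSize.{u, u} CPMet.{u} :=
  hasColimits_of_coreflective incl

end CPMet

/-! ### Filtered colimits and presentability -/

theorem hasCardinalLT_alephOne_of_countable (Q : Type*) [Countable Q] :
    HasCardinalLT Q (ℵ₁ : Cardinal.{u}) := by
  unfold HasCardinalLT
  refine lt_of_le_of_lt (Cardinal.lift_le_aleph0.2 (Cardinal.mk_le_aleph0 (α := Q))) ?_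
  simp

namespace CMet

/-- The infimum over the diagram of the distances between images of two points. -/
noncomputable abbrev filteredPseudoEMetric {J : Type u} [Category.{u} J] [IsFiltered J]
    (F : J ⥤ CMet.{u}) : PseudoEMetricSpace (DiagramPt F) where
  edist x y := ⨅ (k : J) (u : x.idx ⟶ k) (v : y.idx ⟶ k), edist (F.map u x.pt) (F.map v y.pt)
  edist_self x := le_antisymm
    ((iInf_le _ x.idx).trans (iInf₂_le_of_le (𝟙 _) (𝟙 _) (by simp))) zero_le
  edist_comm x y := by
    refine iInf_congr fun k => ?_
    rw [iInf_comm]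
    simp only [edist_comm]
  edist_triangle x y z := by
    simp only [ENNReal.iInf_add, ENNReal.add_iInf]
    refine le_iInf fun k => le_iInf fun u => le_iInf fun v => le_iInf fun l => le_iInf fun u' =>
      le_iInf fun v' => ?_
    -- The two distances use different images of the middle point `y`; these are identified at `m`.
    obtain ⟨m, a, b, h⟩ := IsFiltered.span v' u
    refine (iInf_le _ m).trans (iInf₂_le_of_le (u' ≫ a) (v ≫ b) ?_)
    refine (edist_triangle _ (F.map (v' ≫ a) y.pt) _).trans (add_le_add ?_ ?_)
    · simpa using edist_map_le (F.map a) (F.map u' x.pt) (F.map v' y.pt)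
    · simpa [h] using edist_map_le (F.map b) (F.map u y.pt) (F.map v z.pt)

end CMet

namespace CPMet

variable {J : Type u} [Category.{u} J] {F : J ⥤ CPMet.{u}}

/-- The legs of a cocone as maps. -/
def leg (c : Cocone F) {j : J} (x : (F.obj j).obj) : c.pt.obj :=
  (c.ι.app j : F.obj j ⟶ c.pt) x

theorem leg_map (c : Cocone F) {j k : J} (f : j ⟶ k) (x : (F.obj j).obj) :
    leg c (F.map f x) = leg c x :=
  ConcreteCategory.congr_hom (c.w f) x

theorem lipschitz_leg (c : Cocone F) (j : J) : LipschitzWith 1 (leg c (j := j)) :=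
  lipschitz_hom (c.ι.app j : F.obj j ⟶ c.pt)

variable {c : Cocone F} (hc : IsColimit c)

include hc

/-- The infimum is the distance in the completed filtered pseudometric. Made intrinsic, that
completion is a cocone in `CPMet`, and the map from the colimit is non-expansive. -/
theorem iInf_edist_le [IsFiltered J] {j k : J} (x : (F.obj j).obj) (y : (F.obj k).obj) :
    ⨅ (l : J) (u : j ⟶ l) (v : k ⟶ l), edist (F.map u x) (F.map v y) ≤
      edist (leg c x) (leg c y) := by
  let _ := CMet.filteredPseudoEMetric (F ⋙ incl)
  have h₁ : ∀ (j : J) (x y : (F ⋙ incl).obj j),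
      edist (CMet.DiagramPt.mk j x) ⟨j, y⟩ ≤ edist x y := fun j x y =>
    (iInf_le _ j).trans (iInf₂_le_of_le (𝟙 j) (𝟙 j) (by simp))
  have h₂ : ∀ (j k : J) (f : j ⟶ k) (x : (F ⋙ incl).obj j),
      edist (CMet.DiagramPt.mk j x) ⟨k, (F ⋙ incl).map f x⟩ = 0 := fun j k f x =>
    le_antisymm ((iInf_le _ k).trans (iInf₂_le_of_le f (𝟙 k) (by simp))) zero_le
  let D := CMet.completionCocone (F ⋙ incl) h₁ h₂
  let c' : Cocone F :=
    { pt := pathify D.pt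
      ι :=
        { app := fun j => pathifyEquiv _ _ (D.ι.app j)
          naturality := fun i j f => hom_ext fun x => Pathify.ext (CMet.leg_map D f x) } }
  let φ : c.pt.obj → D.pt := fun z => (hc.desc c' z : Pathify D.pt).val
  have hφ : LipschitzWith 1 φ := Pathify.lipschitz_val.comp_one (lipschitz_hom (hc.desc c'))
  have hφl : ∀ {i : J} (x : (F.obj i).obj), φ (leg c x) = CMet.leg D x := fun {i} x =>
    congrArg Pathify.val (ConcreteCategory.congr_hom (hc.fac c' i) x)
  have := hφ.edist_le_one (leg c x) (leg c y)
  rw [hφl, hφl] at this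
  exact (CMet.edist_leg_completionCocone (F ⋙ incl) h₁ h₂ x y).ge.trans this

variable [IsCardinalFiltered J (ℵ₁ : Cardinal.{u})]

/-- The infimum is attained: stages approximating it up to a sequence `ε n` have a common upper
bound, `J` being `ℵ₁`-filtered. -/
theorem exists_edist_map_le {j : J} (x y : (F.obj j).obj) :
    ∃ (k : J) (u : j ⟶ k), edist (F.map u x) (F.map u y) ≤ edist (leg c x) (leg c y) := by
  have := isFiltered_of_isCardinalFiltered J (ℵ₁ : Cardinal.{u})
  rcases eq_or_ne (edist (leg c x) (leg c y)) ∞ with h | h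
  · exact ⟨j, 𝟙 j, by rw [h]; exact le_top⟩
  obtain ⟨ε, -, hε, hlim⟩ := exists_seq_strictAnti_tendsto' h.lt_top
  have hex : ∀ n, ∃ (k : J) (u : j ⟶ k), edist (F.map u x) (F.map u y) ≤ ε n := by
    intro n
    have hlt := (iInf_edist_le hc x y).trans_lt (hε n).1
    simp only [iInf_lt_iff] at hlt
    obtain ⟨l, u, v, hlt⟩ := hlt
    -- The infimum allows different maps `u`, `v` for the two points; one further stage makes them
    -- equal.
    refine ⟨IsFiltered.coeq u v, u ≫ IsFiltered.coeqHom u v, ?_⟩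
    conv_lhs => enter [2]; rw [IsFiltered.coeq_condition]
    refine le_trans ?_ hlt.le
    simpa using (lipschitz_hom (F.map (IsFiltered.coeqHom u v))).edist_le_one (F.map u x) (F.map v y)
  choose k u hu using hex
  obtain ⟨m, a, b, hab⟩ := IsCardinalFiltered.wideSpan u
    (hasCardinalLT_alephOne_of_countable.{u} ℕ)
  refine ⟨m, b, ge_of_tendsto' hlim fun n => le_trans ?_ (hu n)⟩
  rw [← hab n]
  simpa using (lipschitz_hom (F.map (a n))).edist_le_one (F.map (u n) x) (F.map (u n) y)

theorem exists_lift_of_countable {Q : Type} [Countable Q] (a : Q → c.pt.obj)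
    (ha : ∀ q, ∃ (j : J) (x : (F.obj j).obj), leg c x = a q) :
    ∃ (k : J) (x : Q → (F.obj k).obj), (∀ q, leg c (x q) = a q) ∧
      ∀ q q', edist (x q) (x q') ≤ edist (a q) (a q') := by
  choose j x hx using ha
  have hQ := hasCardinalLT_alephOne_of_countable.{u} Q
  let x' : ∀ q, (F.obj (IsCardinalFiltered.max j hQ)).obj := fun q =>
    F.map (IsCardinalFiltered.toMax j hQ q) (x q)
  have hx' : ∀ q, leg c (x' q) = a q := fun q => (leg_map c _ _).trans (hx q)
  choose k u hu using fun p : Q × Q => exists_edist_map_le hc (x' p.1) (x' p.2)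
  obtain ⟨m, v, b, hb⟩ := IsCardinalFiltered.wideSpan u
    (hasCardinalLT_alephOne_of_countable.{u} (Q × Q))
  refine ⟨m, fun q => F.map b (x' q), fun q => (leg_map c _ _).trans (hx' q), fun q q' => ?_⟩
  rw [← hx' q, ← hx' q']
  refine le_trans ?_ (hu (q, q'))
  rw [← hb (q, q')]
  simpa using (lipschitz_hom (F.map (v (q, q')))).edist_le_one
    (F.map (u (q, q')) (x' q)) (F.map (u (q, q')) (x' q'))

/-- The union `A` of the images is complete and a path metric space, since Cauchy sequences and
pairs of points lift to one stage. So `A` is a cocone, and the colimit retracts through it. -/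
theorem exists_leg_eq (z : c.pt.obj) : ∃ (j : J) (x : (F.obj j).obj), leg c x = z := by
  let A : Set c.pt.obj := {z | ∃ (j : J) (x : (F.obj j).obj), leg c x = z}
  have hcomp : CompleteSpace A := by
    refine EMetric.complete_of_cauchySeq_tendsto fun s hs => ?_
    obtain ⟨k, x, hx, hle⟩ := exists_lift_of_countable hc (fun n => (s n : c.pt.obj))
      fun n => (s n).2
    have hxc : CauchySeq x := by
      rw [EMetric.cauchySeq_iff] at hs ⊢
      intro ε hε
      obtain ⟨N, hN⟩ := hs ε hε
      exact ⟨N, fun m hm n hn => (hle m n).trans_lt (hN m hm n hn)⟩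
    obtain ⟨y, hy⟩ := cauchySeq_tendsto_of_complete hxc
    refine ⟨⟨leg c y, k, y, rfl⟩, tendsto_subtype_rng.2 ?_⟩
    exact (((lipschitz_leg c k).continuous.tendsto y).comp hy).congr hx
  have hpath : IsPathMetric A := by
    refine isPathMetric_iff_lipJoined.2 fun y z r hr => ?_
    obtain ⟨k, x, hx, hle⟩ := exists_lift_of_countable hc
      (fun b : Bool => ((if b then y else z : A) : c.pt.obj)) fun b => (if b then y else z : A).2
    have hj := isPathMetric_iff_lipJoined.1 (F.obj k).property (x true) (x false) r
      ((hle true false).trans_lt hr)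
    have hl : LipschitzWith 1 (fun w : (F.obj k).obj => (⟨leg c w, k, w, rfl⟩ : A)) :=
      LipschitzWith.of_edist_le_one fun v w => (lipschitz_leg c k).edist_le_one v w
    have := hj.map hl
    have ht : (⟨leg c (x true), k, x true, rfl⟩ : A) = y := Subtype.ext (hx true)
    have hf : (⟨leg c (x false), k, x false, rfl⟩ : A) = z := Subtype.ext (hx false)
    rwa [ht, hf] at this
  let c' : Cocone F :=
    { pt := { obj := { carrier := A }, property := hpath }
      ι :=
        { app := fun j => homMk (fun x => (⟨leg c x, j, x, rfl⟩ : A))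
            (LipschitzWith.of_edist_le_one fun v w => (lipschitz_leg c j).edist_le_one v w)
          naturality := fun i j f => hom_ext fun x => Subtype.ext (leg_map c f x) } }
  let i : c'.pt ⟶ c.pt := homMk (fun z : A => (z : c.pt.obj))
    (LipschitzWith.of_edist_le_one fun v w => le_rfl)
  have hi : hc.desc c' ≫ i = 𝟙 c.pt := hc.hom_ext fun j => by
    rw [hc.fac_assoc, Category.comp_id]
    rfl
  have : ((hc.desc c' z : A) : c.pt.obj) = z := by
    have h := ConcreteCategory.congr_hom hi z
    exact h
  rw [← this]
  exact (hc.desc c' z : A).2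

omit hc in
instance (ℓ : ℝ≥0) : TopologicalSpace.SeparableSpace (segment.{u} ℓ).obj :=
  inferInstanceAs (TopologicalSpace.SeparableSpace (ULift.{u} (Set.Icc (0 : ℝ) ℓ)))

omit hc in
instance (ℓ : ℝ≥0) : Nonempty (segment.{u} ℓ).obj := ⟨ULift.up ⟨0, by simp⟩⟩

/-- A dense sequence lifts to one stage without increasing distances, and the lift extends because
the stage is complete. -/
theorem exists_factor_of_separableSpace {S : CPMet.{u}} [TopologicalSpace.SeparableSpace S.obj]
    [Nonempty S.obj] (γ : S ⟶ c.pt) : ∃ (j : J) (f : S ⟶ F.obj j), f ≫ c.ι.app j = γ := by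
  let q := TopologicalSpace.denseSeq S.obj
  have hq : DenseRange q := TopologicalSpace.denseRange_denseSeq _
  obtain ⟨k, x, hx, hle⟩ := exists_lift_of_countable hc (fun n => γ (q n))
    fun n => exists_leg_eq hc _
  obtain ⟨g, hg, hgq⟩ := LipschitzWith.exists_extend hq (f := x) fun m n =>
    (hle m n).trans ((lipschitz_hom γ).edist_le_one _ _)
  refine ⟨k, homMk g hg, hom_ext fun s => ?_⟩
  refine congrFun (hq.equalizer ((lipschitz_leg c k).continuous.comp hg.continuous)
    (lipschitz_hom γ).continuous (funext fun n => ?_)) s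
  simp [hgq, hx]

theorem exists_map_eq_of_separableSpace {S : CPMet.{u}} [TopologicalSpace.SeparableSpace S.obj]
    [Nonempty S.obj] {j : J} (f g : S ⟶ F.obj j) (h : f ≫ c.ι.app j = g ≫ c.ι.app j) :
    ∃ (k : J) (u : j ⟶ k), f ≫ F.map u = g ≫ F.map u := by
  let q := TopologicalSpace.denseSeq S.obj
  have hq : DenseRange q := TopologicalSpace.denseRange_denseSeq _
  choose k u hu using fun n => exists_edist_map_le hc (f (q n)) (g (q n))
  obtain ⟨m, v, b, hb⟩ := IsCardinalFiltered.wideSpan u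
    (hasCardinalLT_alephOne_of_countable.{u} ℕ)
  refine ⟨m, b, hom_ext fun s => ?_⟩
  refine congrFun (hq.equalizer (lipschitz_hom (f ≫ F.map b)).continuous
    (lipschitz_hom (g ≫ F.map b)).continuous (funext fun n => ?_)) s
  have h0 : leg c (f (q n)) = leg c (g (q n)) := ConcreteCategory.congr_hom h (q n)
  have h1 : F.map (u n) (f (q n)) = F.map (u n) (g (q n)) :=
    edist_le_zero.1 ((hu n).trans_eq (by rw [h0, edist_self]))
  simp [← hb n, h1]

omit hc in
theorem isCardinalPresentable_of_separableSpace (S : CPMet.{u})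
    [TopologicalSpace.SeparableSpace S.obj] [Nonempty S.obj] :
    IsCardinalPresentable S (ℵ₁ : Cardinal.{u}) where
  preservesColimitOfShape J _ _ := ⟨fun {F} => ⟨fun {c} hc => by
    have := isFiltered_of_isCardinalFiltered J (ℵ₁ : Cardinal.{u})
    refine ⟨Types.FilteredColimit.isColimitOf' _ _ (fun γ => ?_) fun j f g h => ?_⟩
    · obtain ⟨j, f, hf⟩ := exists_factor_of_separableSpace hc γ
      exact ⟨j, f, hf.symm⟩
    · exact exists_map_eq_of_separableSpace hc f g h⟩⟩

end CPMet

/-! ### Monomorphisms and the strong generator -/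

namespace CMet

theorem mono_iff_injective {X Y : CMet.{u}} (f : X ⟶ Y) : Mono f ↔ Function.Injective f := by
  refine ⟨fun _ x y h => ?_, fun h => ConcreteCategory.mono_of_injective f h⟩
  let P : CMet.{u} := { carrier := PUnit.{u + 1} }
  let p : X → (P ⟶ X) := fun x => homMk (fun _ => x) (LipschitzWith.const' x)
  have : p x = p y := (cancel_mono f).1 (hom_ext fun _ => h)
  exact ConcreteCategory.congr_hom this (PUnit.unit : P)

end CMet

namespace CPMet

/-- The map from the one-point segment given by a point. -/
def pointMap (X : CPMet.{u}) (x : X.obj) : segment.{u} 0 ⟶ X :=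
  homMk (fun _ => x) (LipschitzWith.const' x)

/-- The restriction of a non-expansive map `ℝ → X` to a segment. -/
def segmentMap (X : CPMet.{u}) (ℓ : ℝ≥0) {γ : ℝ → X.obj} (hγ : LipschitzWith 1 γ) :
    segment.{u} ℓ ⟶ X :=
  homMk (fun t : Segment.{u} ℓ => γ t.down) (LipschitzWith.of_edist_le_one fun s t =>
    hγ.edist_le_one (s : Segment.{u} ℓ).down (t : Segment.{u} ℓ).down)

theorem mono_iff_injective {X Y : CPMet.{u}} (f : X ⟶ Y) : Mono f ↔ Function.Injective f := by
  refine ⟨fun _ x y h => ?_, fun h => ConcreteCategory.mono_of_injective f h⟩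
  have : pointMap X x = pointMap X y := (cancel_mono f).1 (hom_ext fun _ => h)
  exact ConcreteCategory.congr_hom this (ULift.up ⟨0, by simp⟩ : Segment.{u} 0)

/-- Lifting points makes a monomorphism `i` bijective. Lifting a curve of length just above the
distance of `i x` and `i x'` bounds the distance of `x` and `x'`, so the inverse is non-expansive.
-/
theorem isStrongGenerator_segment : (ObjectProperty.ofObj segment.{u}).IsStrongGenerator := by
  rw [ObjectProperty.isStrongGenerator_iff]
  refine ⟨fun X Y f g h => hom_ext fun x => ?_, fun X Y i _ h => ?_⟩
  · exact ConcreteCategory.congr_hom (h _ (ObjectProperty.ofObj_apply _ 0) (pointMap X x))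
      (ULift.up ⟨0, by simp⟩ : Segment.{u} 0)
  · have hinj := (mono_iff_injective i).1 inferInstance
    have hsurj : Function.Surjective i := fun y => by
      obtain ⟨f, hf⟩ := h _ (ObjectProperty.ofObj_apply _ 0) (pointMap Y y)
      exact ⟨f (ULift.up ⟨0, by simp⟩ : Segment.{u} 0),
        ConcreteCategory.congr_hom hf (ULift.up ⟨0, by simp⟩ : Segment.{u} 0)⟩
    have hle : ∀ x x' : X.obj, edist x x' ≤ edist (i x) (i x') := by
      intro x x'
      refine le_of_forall_gt fun c hc => ?_
      obtain ⟨r, hr, hrc⟩ := ENNReal.lt_iff_exists_nnreal_btwn.1 hc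
      obtain ⟨γ, hγ, h0, h1⟩ := isPathMetric_iff_lipJoined.1 Y.property _ _ r hr
      obtain ⟨f, hf⟩ := h _ (ObjectProperty.ofObj_apply _ r) (segmentMap Y r hγ)
      let s₀ : Segment.{u} r := ULift.up ⟨0, by simp⟩
      let s₁ : Segment.{u} r := ULift.up ⟨r, by simp⟩
      have e0 : f s₀ = x := hinj ((ConcreteCategory.congr_hom hf s₀).trans h0)
      have e1 : f s₁ = x' := hinj ((ConcreteCategory.congr_hom hf s₁).trans h1)
      refine lt_of_le_of_lt ?_ hrc
      rw [← e0, ← e1]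
      refine ((lipschitz_hom f).edist_le_one s₀ s₁).trans_eq ?_
      change edist (0 : ℝ) r = r
      rw [edist_comm, edist_dist, Real.dist_eq, sub_zero, abs_of_nonneg r.coe_nonneg]
      exact ENNReal.ofReal_coe_nnreal
    choose g hg using hsurj
    refine ⟨homMk g (LipschitzWith.of_edist_le_one fun y y' => ?_), hom_ext fun x => ?_,
      hom_ext fun y => hg y⟩
    · exact (hle _ _).trans_eq (by rw [hg, hg])
    · exact hinj (hg (i x))

theorem isCardinalPresentable_segment (ℓ : ℝ≥0) :
    IsCardinalPresentable (segment.{u} ℓ) (ℵ₁ : Cardinal.{u}) :=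
  isCardinalPresentable_of_separableSpace _

end CPMet

theorem mainTheorem4 :
    -- the category is locally `ℵ₁`-presentable
    IsCardinalLocallyPresentable CPMet.{u} (ℵ₁ : Cardinal.{u}) ∧
    -- the segments are `ℵ₁`-presentable
    (∀ ℓ : ℝ≥0, IsCardinalPresentable (CPMet.segment.{u} ℓ) (ℵ₁ : Cardinal.{u})) ∧
    -- the segments form a strong generator
    (ObjectProperty.ofObj CPMet.segment.{u}).IsStrongGenerator ∧
    -- every object is an extremal quotient of a coproduct of segments
    (∀ X : CPMet.{u}, ∃ (ι : Type u) (ℓ : ι → ℝ≥0)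
      (c : Cofan fun i => CPMet.segment.{u} (ℓ i)) (_ : IsColimit c) (e : c.pt ⟶ X),
      ExtremalEpi e) ∧
    -- the monomorphisms are the injections, in both categories
    (∀ (X Y : CPMet.{u}) (f : X ⟶ Y), Mono f ↔ Function.Injective f) ∧
    (∀ (X Y : CMet.{u}) (f : X ⟶ Y), Mono f ↔ Function.Injective f) := by
  refine ⟨?_, CPMet.isCardinalPresentable_segment, CPMet.isStrongGenerator_segment, fun X => ?_,
    fun _ _ => CPMet.mono_iff_injective, fun _ _ => CMet.mono_iff_injective⟩
  · refine (IsCardinalLocallyPresentable.iff_exists_isStrongGenerator CPMet.{u} ℵ₁).2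
      ⟨ObjectProperty.ofObj CPMet.segment.{u}, inferInstance, CPMet.isStrongGenerator_segment, ?_⟩
    rintro _ ⟨ℓ⟩
    exact CPMet.isCardinalPresentable_segment ℓ
  · obtain ⟨ι, s, hs, c, hc, p, hp⟩ :=
      ObjectProperty.isStrongGenerator_iff_exists_extremalEpi.{u}.1
        CPMet.isStrongGenerator_segment.{u} X
    choose ℓ hℓ using fun i => (ObjectProperty.ofObj_iff _ _).1 (hs i)
    obtain rfl : (fun i => CPMet.segment (ℓ i)) = s := funext hℓ
    exact ⟨ι, ℓ, c, hc, p, hp⟩
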